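/- Let $M\subset\mathbb{R}^N$ be a smooth embedded submanifold (without boundary) of dimension $n$ that is a closed subset of $\mathbb{R}^N$ (compact or not). For $p\in\mathbb{R}^N$ let $d(p,M)=\inf_{s\in M}|s-p|$ be the distance from $p$ to $M$, where $|\cdot|$ is the Euclidean norm, and let $\pi_M(p)=\{x\in M: |p-x|=d(p,M)\}$ be the set of nearest points on $M$. Let $$\tau=\sup\{r\ge 0:\ |\pi_M(p)|=1 \text{ for every } p\in\mathbb{R}^N \text{ with } d(p,M)<r\}\in[0,\infty]$$ be the reach of $M$. For $x,y\in M$ let $d_M(x,y)\in[0,\infty]$ be the geodesic distance of the Riemannian metric on $M$ induced by the Euclidean metric, that is, the infimum of the lengths of $C^1$ curves in $M$ from $x$ to $y$ ($\infty$ if there are none). If $x,y\in M$ and $|x-y|<\frac{\tau}{2}$, then $$d_M(x,y)\le 2\,|x-y|.$$ In particular $d_M(x,y)$ is finite. -/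

import Mathlib

open Set Manifold
open scoped ContDiff NNReal ENNReal

noncomputable section

/-- The set `π_M(p)` of points of `M` that realise the distance from `p` to `M`. -/
def nearestPoints {N : ℕ} (M : Set (EuclideanSpace ℝ (Fin N))) (p : EuclideanSpace ℝ (Fin N)) :
    Set (EuclideanSpace ℝ (Fin N)) :=
  {x | x ∈ M ∧ Metric.infDist p M = dist p x}

/-- The reach of `M`: the supremum of all real `r ≥ 0` such that every point of the ambient space
at distance less than `r` from `M` has exactly one nearest point on `M`. It is an extended
nonnegative real; the value `∞` occurs for instance for affine subspaces. -/
def reach {N : ℕ} (M : Set (EuclideanSpace ℝ (Fin N))) : ℝ≥0∞ :=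
  ⨆ r ∈ {r : ℝ≥0 | ∀ p : EuclideanSpace ℝ (Fin N),
    Metric.infDist p M < r → (nearestPoints M p).encard = 1}, (r : ℝ≥0∞)

/-- The norm on the tangent spaces of `M ⊆ ℝ^N` given by the induced Riemannian metric: the length
of a tangent vector is the Euclidean length of its image under the differential of the
inclusion `M → ℝ^N`. -/
@[reducible] def inducedENorm (n : ℕ) {N : ℕ} (M : Set (EuclideanSpace ℝ (Fin N)))
    [ChartedSpace (EuclideanSpace ℝ (Fin n)) M] (x : M) : ENorm (TangentSpace (𝓡 n) x) where
  enorm v := enorm (E := EuclideanSpace ℝ (Fin N))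
    (mfderiv (𝓡 n) (𝓡 N) (Subtype.val : M → EuclideanSpace ℝ (Fin N)) x v)

/-- The intrinsic (geodesic) distance `d_M` of the induced Riemannian metric: the infimum of the
lengths of the `C^1` curves in `M` from `x` to `y`. It is `∞` if there are no such curves. -/
def intrinsicEDist (n : ℕ) {N : ℕ} (M : Set (EuclideanSpace ℝ (Fin N)))
    [ChartedSpace (EuclideanSpace ℝ (Fin n)) M] (x y : M) : ℝ≥0∞ :=
  letI := inducedENorm n M
  riemannianEDist (𝓡 n) x y

end

/-! Project the segment from `x` to `y` onto `M`. Where nearest points are unique, the distance to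
`M` grows at unit rate along the ray from a nearest point `a`, so an open ball of radius `t < T`
tangent to `M` at `a` along this ray misses `M`. This gives Federer's inequality
`inner_sub_nearest_le`, and adding two instances of it shows that the projection is `4/3`-Lipschitz
at distance at most `t / 4` (`dist_nearest_le`). The segment stays that close for `t = 2 * dist x
y`, which is where half the reach enters.

The projected curve is only Lipschitz, not `C^1`. But locally the intrinsic distance is at most
`3/2` times the chord (`eventually_intrinsicEDist_le`), and continuous induction along the curve
gives the factor `3/2 * 4/3 = 2`. -/

/-! ### Nearest points and Federer's inequality -/

section Reach

open Metric Filter Topology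
open scoped RealInnerProductSpace

variable {N : ℕ} {M : Set (EuclideanSpace ℝ (Fin N))} {T : ℝ}

/-- Every point at distance less than `T` from `M` has at most one nearest point on `M`. -/
def UniqueNearestWithin (M : Set (EuclideanSpace ℝ (Fin N))) (T : ℝ) : Prop :=
  ∀ p, infDist p M < T → (nearestPoints M p).Subsingleton

theorem nearestPoints_nonempty (hM : IsClosed M) (hne : M.Nonempty)
    (p : EuclideanSpace ℝ (Fin N)) : (nearestPoints M p).Nonempty := by
  obtain ⟨a, ha, h⟩ := hM.exists_infDist_eq_dist hne p
  exact ⟨a, ha, h⟩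

/-- Compactness: nearest points of `q k → p` stay bounded, and any limit of them is nearest to `p`,
hence equals `a`. -/
theorem exists_nearestPoints_close (hM : IsClosed M) (hT : UniqueNearestWithin M T)
    {p a : EuclideanSpace ℝ (Fin N)} (hp : infDist p M < T) (ha : a ∈ nearestPoints M p)
    {ε : ℝ} (hε : 0 < ε) :
    ∃ η > 0, ∀ q, dist q p < η → ∀ b ∈ nearestPoints M q, dist b a < ε := by
  by_contra! hcon
  choose q hq b hb hba using fun k : ℕ => hcon (1 / ((k : ℝ) + 1)) (by positivity)
  have hq_lim : Tendsto q atTop (𝓝 p) := by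
    rw [tendsto_iff_dist_tendsto_zero]
    exact squeeze_zero (fun _ => dist_nonneg) (fun k => (hq k).le)
      tendsto_one_div_add_atTop_nhds_zero_nat
  have hinf : Tendsto (fun k => infDist (q k) M) atTop (𝓝 (infDist p M)) :=
    ((continuous_infDist_pt M).tendsto p).comp hq_lim
  have hbdd : ∀ k, b k ∈ closedBall p (infDist p M + 2) := by
    intro k
    have h1 : dist (q k) p ≤ 1 := (hq k).le.trans (by
      rw [div_le_one (by positivity)]; linarith [Nat.cast_nonneg (α := ℝ) k])
    have h2 := infDist_le_infDist_add_dist (x := q k) (y := p) (s := M)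
    have h3 := (hb k).2
    rw [mem_closedBall]
    linarith [dist_triangle (b k) (q k) p, dist_comm (b k) (q k)]
  obtain ⟨c, -, φ, hφ, hc⟩ := (isCompact_closedBall p _).tendsto_subseq hbdd
  have hcM : c ∈ M := hM.mem_of_tendsto hc (Eventually.of_forall fun k => (hb (φ k)).1)
  have hcp : infDist p M = dist p c := by
    refine tendsto_nhds_unique (hinf.comp hφ.tendsto_atTop) ?_
    refine ((hq_lim.comp hφ.tendsto_atTop).dist hc).congr fun k => ?_
    exact ((hb (φ k)).2).symm
  have hca : c = a := hT p hp ⟨hcM, hcp⟩ ha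
  have : ε ≤ dist c a :=
    ge_of_tendsto (hc.dist tendsto_const_nhds) (Eventually.of_forall fun k => hba (φ k))
  rw [hca, dist_self] at this
  exact absurd this (not_le.mpr hε)

/-- The distance function increases at unit rate away from the nearest point. -/
theorem exists_infDist_increase (hM : IsClosed M) (hT : UniqueNearestWithin M T)
    {z : EuclideanSpace ℝ (Fin N)} (hne : M.Nonempty) (hz : infDist z M < T)
    (hpos : 0 < infDist z M) {c : ℝ} (hc0 : 0 ≤ c) (hc : c < 1) {r : ℝ} (hr : 0 < r) :
    ∃ z', 0 < dist z' z ∧ dist z' z < r ∧ infDist z M + c * dist z' z ≤ infDist z' M := by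
  obtain ⟨b, hb⟩ := nearestPoints_nonempty hM hne z
  set d := infDist z M with hd
  have hdb : ‖z - b‖ = d := by rw [← dist_eq_norm]; exact hb.2.symm
  -- With this `ε`, moving the foot from `b` to `b'` lowers the inner product with `w` from `d` to
  -- no less than `c * d`.
  obtain ⟨η, hη, hclose⟩ := exists_nearestPoints_close hM hT hz hb
    (ε := (1 - c) * d) (mul_pos (by linarith) hpos)
  set h := min η r / 2 with hh
  have hmin : 0 < min η r := lt_min hη hr
  have hh0 : 0 < h := by positivity
  have hhη : h < η := by have := min_le_left η r; linarith
  have hhr : h < r := by have := min_le_right η r; linarith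
  set w := d⁻¹ • (z - b) with hw
  have hwn : ‖w‖ = 1 := by
    rw [hw, norm_smul, hdb, norm_inv, Real.norm_of_nonneg hpos.le, inv_mul_cancel₀ hpos.ne']
  have hdist : dist (z + h • w) z = h := by
    rw [dist_eq_norm, add_sub_cancel_left, norm_smul, hwn, Real.norm_of_nonneg hh0.le, mul_one]
  refine ⟨z + h • w, by rwa [hdist], by rwa [hdist], ?_⟩
  obtain ⟨b', hb'⟩ := nearestPoints_nonempty hM hne (z + h • w)
  have hbb := hclose _ (by rwa [hdist]) b' hb'
  rw [hdist, hb'.2, dist_eq_norm]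
  have hge : d ≤ ‖z - b'‖ := by rw [← dist_eq_norm]; exact infDist_le_dist_of_mem hb'.1
  have hin : c * d ≤ ⟪z - b', w⟫ := by
    have h1 : ⟪z - b, w⟫ = d := by
      rw [hw, inner_smul_right, real_inner_self_eq_norm_sq, hdb]; field_simp
    have h2 : |⟪b' - b, w⟫| ≤ ‖b' - b‖ * ‖w‖ := abs_real_inner_le_norm _ _
    rw [hwn, mul_one, ← dist_eq_norm] at h2
    have h3 : ⟪z - b', w⟫ = ⟪z - b, w⟫ - ⟪b' - b, w⟫ := by
      rw [← inner_sub_left]; congr 1; abel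
    have := (abs_le.mp h2).2
    rw [h3, h1]; linarith
  have hsq : ‖z + h • w - b'‖ ^ 2 = ‖z - b'‖ ^ 2 + 2 * h * ⟪z - b', w⟫ + h ^ 2 := by
    rw [show z + h • w - b' = (z - b') + h • w by abel, norm_add_sq_real, inner_smul_right,
      norm_smul, hwn, Real.norm_of_nonneg hh0.le]
    ring
  refine le_of_sq_le_sq ?_ (norm_nonneg _)
  rw [hsq]
  have e1 : d ^ 2 ≤ ‖z - b'‖ ^ 2 := by gcongr
  have e2 : h * (c * d) ≤ h * ⟪z - b', w⟫ := by gcongr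
  have e3 : c ^ 2 * h ^ 2 ≤ h ^ 2 := by
    have : c ^ 2 ≤ 1 := by nlinarith
    nlinarith [sq_nonneg h]
  nlinarith

/-- Maximise `infDist z M - c * dist z q` over the ball. At an interior point the distance can still
increase with slope `(1 + c) / 2 > c`, so the maximum lies on the sphere. -/
theorem exists_infDist_ge_of_slope (hM : IsClosed M) (hT : UniqueNearestWithin M T)
    (hne : M.Nonempty) {q : EuclideanSpace ℝ (Fin N)} {s : ℝ} (hs : 0 < s)
    (hsq : s < infDist q M) (hsT : infDist q M + s < T) {c : ℝ} (hc0 : 0 ≤ c) (hc : c < 1) :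
    ∃ z ∈ closedBall q s, infDist q M + c * s ≤ infDist z M := by
  obtain ⟨z, hz, hmax⟩ := (isCompact_closedBall q s).exists_isMaxOn
    ⟨q, mem_closedBall_self hs.le⟩
    (f := fun z => infDist z M - c * dist z q) (by
      have := continuous_infDist_pt M; fun_prop)
  have hzq := hmax (mem_closedBall_self hs.le)
  simp only [mem_ofPred_eq, dist_self, mul_zero, sub_zero] at hzq
  refine ⟨z, hz, ?_⟩
  rcases (mem_closedBall.mp hz).lt_or_eq with hlt | heq
  · exfalso
    have h1 := infDist_le_infDist_add_dist (x := z) (y := q) (s := M)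
    have h2 := infDist_le_infDist_add_dist (x := q) (y := z) (s := M)
    rw [dist_comm q z] at h2
    obtain ⟨z', hz'0, hz', hinc⟩ := exists_infDist_increase hM hT hne (z := z) (by linarith)
      (by linarith) (c := (1 + c) / 2) (by linarith) (by linarith) (sub_pos.mpr hlt)
    have hz'mem : z' ∈ closedBall q s := by
      rw [mem_closedBall]; linarith [dist_triangle z' z q]
    have hle := hmax hz'mem
    simp only [mem_ofPred_eq] at hle
    have htri : c * dist z' q ≤ c * (dist z' z + dist z q) := by
      gcongr; exact dist_triangle _ _ _
    nlinarith
  · rw [heq] at hzq; linarith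

/-- Inside the region of unique projection, moving away from the nearest point `a` along the
normal ray keeps `a` a nearest point. -/
theorem infDist_add_smul_of_small (hM : IsClosed M) (hT : UniqueNearestWithin M T)
    {q a : EuclideanSpace ℝ (Fin N)} (ha : a ∈ nearestPoints M q) {s : ℝ} (hs : 0 < s)
    (hsq : s < infDist q M) (hsT : infDist q M + s < T) :
    infDist (q + s • ((infDist q M)⁻¹ • (q - a))) M = infDist q M + s := by
  have hne : M.Nonempty := ⟨a, ha.1⟩
  set t := infDist q M with ht
  have htpos : 0 < t := hs.trans hsq
  have hqa : ‖q - a‖ = t := by rw [← dist_eq_norm]; exact ha.2.symm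
  obtain ⟨z, hz, hmax⟩ := (isCompact_closedBall q s).exists_isMaxOn
    ⟨q, mem_closedBall_self hs.le⟩ (f := fun z => infDist z M)
    (continuous_infDist_pt M).continuousOn
  -- Let the slope `c` tend to `1`.
  have hzge : t + s ≤ infDist z M := by
    refine le_of_forall_lt fun u hu => ?_
    obtain ⟨c, hc, hc1⟩ : ∃ c, max 0 ((u - t) / s) < c ∧ c < 1 :=
      exists_between (max_lt one_pos (by rw [div_lt_one hs]; linarith))
    obtain ⟨z', hz', hle⟩ := exists_infDist_ge_of_slope hM hT hne hs hsq hsT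
      ((le_max_left _ _).trans hc.le) hc1
    have h1 : (u - t) / s < c := (le_max_right _ _).trans_lt hc
    rw [div_lt_iff₀ hs] at h1
    have h2 := hmax hz'
    simp only [mem_ofPred_eq] at h2
    linarith
  have hzq : ‖z - q‖ ≤ s := by rw [← dist_eq_norm]; exact hz
  have hza : infDist z M ≤ ‖z - a‖ := by
    rw [← dist_eq_norm]; exact infDist_le_dist_of_mem ha.1
  have hadd : ‖(z - q) + (q - a)‖ = ‖z - a‖ := by rw [sub_add_sub_cancel]
  have htri := norm_add_le (z - q) (q - a)
  -- Equality holds in the triangle inequality through `q`, so `z` lies on the ray from `a` through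
  -- `q`.
  have hzq' : ‖z - q‖ = s := le_antisymm hzq (by linarith)
  have hray : SameRay ℝ (z - q) (q - a) := by
    rw [sameRay_iff_norm_add]; linarith
  have hzeq : z = q + s • (t⁻¹ • (q - a)) := by
    have h1 := sameRay_iff_norm_smul_eq.mp hray
    rw [hzq', hqa] at h1
    rw [smul_comm, h1, smul_smul, inv_mul_cancel₀ htpos.ne', one_smul]
    abel
  rw [← hzeq]
  linarith

/-- Continuous induction on `[d, t]`: the good parameters form a closed set, and
`infDist_add_smul_of_small` prolongs it to the right. -/
theorem infDist_normal_ray (hM : IsClosed M) (hT : UniqueNearestWithin M T)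
    {p a : EuclideanSpace ℝ (Fin N)} (ha : a ∈ nearestPoints M p) (hp : 0 < infDist p M)
    {t : ℝ} (htp : infDist p M ≤ t) (htT : t < T) :
    infDist (a + t • ((infDist p M)⁻¹ • (p - a))) M = t := by
  set d := infDist p M with hd
  have hpa : ‖p - a‖ = d := by rw [← dist_eq_norm]; exact ha.2.symm
  set v := d⁻¹ • (p - a) with hv
  have hvn : ‖v‖ = 1 := by
    rw [hv, norm_smul, hpa, norm_inv, Real.norm_of_nonneg hp.le, inv_mul_cancel₀ hp.ne']
  have hclosed : IsClosed ({u : ℝ | infDist (a + u • v) M = u} ∩ Icc d t) := by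
    refine IsClosed.inter (isClosed_eq ?_ continuous_id) isClosed_Icc
    exact (continuous_infDist_pt M).comp (by fun_prop)
  refine hclosed.Icc_subset_of_forall_exists_gt ?_ ?_ ⟨htp, le_rfl⟩
  · simp only [mem_ofPred_eq, hv, smul_smul, mul_inv_cancel₀ hp.ne', one_smul, add_sub_cancel]
    exact hd.symm
  · rintro u ⟨hu, hdu, hut⟩ y hy
    simp only [mem_ofPred_eq] at hu
    have hupos : 0 < u := hp.trans_le hdu
    rw [mem_Ioi] at hy
    set s := min (u / 2) (min (y - u) (t - u)) with hs
    have hs0 : 0 < s := lt_min (by linarith) (lt_min (by linarith) (by linarith))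
    have hs1 : s ≤ u / 2 := min_le_left _ _
    have hs2 : s ≤ y - u := (min_le_right _ _).trans (min_le_left _ _)
    have hs3 : s ≤ t - u := (min_le_right _ _).trans (min_le_right _ _)
    have hnear : a ∈ nearestPoints M (a + u • v) := by
      refine ⟨ha.1, ?_⟩
      rw [hu, dist_eq_norm, add_sub_cancel_left, norm_smul, hvn, mul_one,
        Real.norm_of_nonneg hupos.le]
    have key := infDist_add_smul_of_small hM hT hnear hs0 (by rw [hu]; linarith)
      (by rw [hu]; linarith)
    rw [hu, add_sub_cancel_left, smul_smul u⁻¹, inv_mul_cancel₀ hupos.ne', one_smul, add_assoc,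
      ← add_smul] at key
    exact ⟨u + s, key, by linarith, by linarith⟩

/-- Federer's inequality for sets of positive reach. -/
theorem inner_sub_nearest_le (hM : IsClosed M) (hT : UniqueNearestWithin M T)
    {p a b : EuclideanSpace ℝ (Fin N)} (ha : a ∈ nearestPoints M p) (hb : b ∈ M)
    {t : ℝ} (ht : 0 < t) (htp : infDist p M ≤ t) (htT : t < T) :
    2 * t * ⟪p - a, b - a⟫ ≤ infDist p M * ‖b - a‖ ^ 2 := by
  set d := infDist p M with hd
  have hpa : ‖p - a‖ = d := by rw [← dist_eq_norm]; exact ha.2.symm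
  rcases (infDist_nonneg : 0 ≤ infDist p M).eq_or_lt with h0 | hp
  · rw [← hd] at h0
    rw [← h0, norm_eq_zero] at hpa
    simp [hpa, ← h0]
  rw [← hd] at hp
  have hray := infDist_normal_ray hM hT ha hp htp htT
  rw [← hd] at hray
  set v := d⁻¹ • (p - a) with hv
  have hvn : ‖v‖ = 1 := by
    rw [hv, norm_smul, hpa, norm_inv, Real.norm_of_nonneg hp.le, inv_mul_cancel₀ hp.ne']
  -- `b` is outside the open ball of radius `t` about `a + t • v`; squaring gives the claim.
  have hle : t ≤ ‖t • v - (b - a)‖ := by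
    have := infDist_le_dist_of_mem (x := a + t • v) hb
    rw [hray, dist_eq_norm] at this
    rwa [show t • v - (b - a) = a + t • v - b by abel]
  have hsq : t ^ 2 ≤ ‖t • v - (b - a)‖ ^ 2 := by gcongr
  rw [norm_sub_sq_real, norm_smul, hvn, mul_one, Real.norm_of_nonneg ht.le, inner_smul_left] at hsq
  have hin : ⟪p - a, b - a⟫ = d * ⟪v, b - a⟫ := by
    rw [hv, real_inner_smul_left, mul_inv_cancel_left₀ hp.ne']
  rw [hin]
  simp only [conj_trivial] at hsq
  nlinarith

/-- The nearest point projection is Lipschitz at small distance from `M`. -/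
theorem dist_nearest_le (hM : IsClosed M) (hT : UniqueNearestWithin M T)
    {p q a b : EuclideanSpace ℝ (Fin N)} (ha : a ∈ nearestPoints M p)
    (hb : b ∈ nearestPoints M q) {t : ℝ} (ht : 0 < t) (htT : t < T)
    (hp : infDist p M ≤ t / 4) (hq : infDist q M ≤ t / 4) :
    dist a b ≤ 4 / 3 * dist p q := by
  have h1 := inner_sub_nearest_le hM hT ha hb.1 ht (by linarith) htT
  have h2 := inner_sub_nearest_le hM hT hb ha.1 ht (by linarith) htT
  rw [norm_sub_rev a b] at h2
  have h1' : infDist p M * ‖b - a‖ ^ 2 ≤ t / 4 * ‖b - a‖ ^ 2 := by gcongr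
  have h2' : infDist q M * ‖b - a‖ ^ 2 ≤ t / 4 * ‖b - a‖ ^ 2 := by gcongr
  have h3 : ⟪p - a, b - a⟫ + ⟪q - b, a - b⟫ = ⟪p - q, b - a⟫ + ‖b - a‖ ^ 2 := by
    rw [← real_inner_self_eq_norm_sq, ← neg_sub b a, inner_neg_right, ← sub_eq_add_neg,
      ← inner_sub_left, ← inner_add_left]
    congr 1; abel
  -- Each Federer inequality contributes `1/8`; what remains is `3/4 * ‖b - a‖ ^ 2 ≤ ‖p - q‖ * ‖b -
  -- a‖`.
  have h4 : ⟪p - a, b - a⟫ + ⟪q - b, a - b⟫ ≤ 1 / 4 * ‖b - a‖ ^ 2 := by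
    have : t * (⟪p - a, b - a⟫ + ⟪q - b, a - b⟫) ≤ t * (1 / 4 * ‖b - a‖ ^ 2) := by linarith
    exact le_of_mul_le_mul_left this ht
  have h5 := (abs_le.mp (abs_real_inner_le_norm (p - q) (b - a))).1
  rw [dist_comm a b, dist_eq_norm, dist_eq_norm]
  rcases (norm_nonneg (b - a)).eq_or_lt with h0 | hpos
  · rw [← h0]; positivity
  · refine le_of_mul_le_mul_right ?_ hpos
    nlinarith

theorem exists_uniqueNearestWithin_of_lt_reach {c : ℝ≥0∞} (hc : c < reach M) :
    ∃ r : ℝ≥0, c < r ∧ UniqueNearestWithin M r := by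
  simp only [reach, lt_iSup_iff] at hc
  obtain ⟨r, hr, hcr⟩ := hc
  exact ⟨r, hcr, fun p hp => encard_le_one_iff_subsingleton.mp (hr p hp).le⟩

/-- The projection of the segment from `x` to `y` is a Lipschitz curve in `M`. -/
theorem exists_lipschitz_curve (hM : IsClosed M) {x y : EuclideanSpace ℝ (Fin N)}
    (hx : x ∈ M) (hy : y ∈ M) (hxy : edist x y < reach M / 2) :
    ∃ γ : ℝ → M, (γ 0 : EuclideanSpace ℝ (Fin N)) = x ∧ (γ 1 : EuclideanSpace ℝ (Fin N)) = y ∧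
      ∀ s ∈ Icc (0 : ℝ) 1, ∀ t ∈ Icc (0 : ℝ) 1,
        dist (γ s) (γ t) ≤ 4 / 3 * dist x y * |s - t| := by
  rcases eq_or_ne x y with rfl | hne
  · exact ⟨fun _ => ⟨x, hx⟩, rfl, rfl, fun s _ t _ => by simp⟩
  have hlt : 2 * edist x y < reach M := by
    have := ENNReal.mul_lt_of_lt_div hxy
    rwa [mul_comm]
  obtain ⟨r, hr, hT⟩ := exists_uniqueNearestWithin_of_lt_reach hlt
  have hr' : 2 * dist x y < r := by
    have := (ENNReal.toReal_lt_toReal (by finiteness) ENNReal.coe_ne_top).mpr hr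
    rwa [ENNReal.toReal_mul, ENNReal.toReal_ofNat, edist_dist, ENNReal.toReal_ofReal dist_nonneg,
      ENNReal.coe_toReal] at this
  have hpos : 0 < dist x y := dist_pos.mpr hne
  choose f hf using nearestPoints_nonempty hM ⟨x, hx⟩
  have hfix : ∀ z ∈ M, f z = z := by
    intro z hz
    have := (hf z).2
    rw [infDist_zero_of_mem hz] at this
    exact (dist_eq_zero.mp this.symm).symm
  let c : ℝ → EuclideanSpace ℝ (Fin N) := fun s => AffineMap.lineMap x y s
  -- The nearer endpoint is at distance at most `dist x y / 2`, which is `t / 4` for `t = 2 * dist x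
  -- y`.
  have hc : ∀ s ∈ Icc (0 : ℝ) 1, infDist (c s) M ≤ 2 * dist x y / 4 := by
    intro s hs
    have h1 : infDist (c s) M ≤ s * dist x y := by
      refine (infDist_le_dist_of_mem hx).trans_eq ?_
      rw [dist_lineMap_left, Real.norm_of_nonneg hs.1]
    have h2 : infDist (c s) M ≤ (1 - s) * dist x y := by
      refine (infDist_le_dist_of_mem hy).trans_eq ?_
      rw [dist_lineMap_right, Real.norm_of_nonneg (by linarith [hs.2])]
    linarith
  refine ⟨fun s => ⟨f (c s), (hf (c s)).1⟩, ?_, ?_, fun s hs t ht => ?_⟩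
  · simp [c, hfix x hx]
  · simp [c, hfix y hy]
  · have := dist_nearest_le hM hT (hf (c s)) (hf (c t)) (by linarith) hr' (hc s hs) (hc t ht)
    rw [dist_lineMap_lineMap, Real.dist_eq] at this
    rw [Subtype.dist_eq]
    linarith

end Reach

/-! ### Intrinsic distance against chords and Lipschitz curves -/

section IntrinsicDistance

open Metric Filter Topology

variable {n N : ℕ} {M : Set (EuclideanSpace ℝ (Fin N))}
  [ChartedSpace (EuclideanSpace ℝ (Fin n)) M]

theorem inducedENorm_enormSMulClass (x : M) :
    letI := inducedENorm n M x
    ENormSMulClass ℝ (TangentSpace (𝓡 n) x) := by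
  let := inducedENorm n M x
  refine ⟨fun r v => ?_⟩
  change enorm (E := EuclideanSpace ℝ (Fin N)) (mfderiv (𝓡 n) (𝓡 N)
    (Subtype.val : M → EuclideanSpace ℝ (Fin N)) x (r • v)) = _
  rw [map_smul]
  exact enorm_smul (β := EuclideanSpace ℝ (Fin N)) r _

theorem intrinsicEDist_self (x : M) : intrinsicEDist n M x x = 0 := by
  let := inducedENorm n M
  have := fun x : M => inducedENorm_enormSMulClass (n := n) x
  exact riemannianEDist_self

theorem intrinsicEDist_triangle [IsManifold (𝓡 n) ∞ M] (x y z : M) :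
    intrinsicEDist n M x z ≤ intrinsicEDist n M x y + intrinsicEDist n M y z := by
  let := inducedENorm n M
  have := fun x : M => inducedENorm_enormSMulClass (n := n) x
  exact riemannianEDist_triangle

/-- A `C^1` curve whose Euclidean speed is at most `C` bounds the intrinsic distance. -/
theorem intrinsicEDist_le_of_speed_le
    (hM : IsSmoothEmbedding (𝓡 n) (𝓡 N) ∞ (Subtype.val : M → EuclideanSpace ℝ (Fin N)))
    {γ : ℝ → M} (hγ : ContMDiffOn 𝓘(ℝ, ℝ) (𝓡 n) 1 γ (Icc 0 1)) {C : ℝ}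
    (hC : ∀ t ∈ Ioo (0 : ℝ) 1, ‖deriv (fun t => (γ t : EuclideanSpace ℝ (Fin N))) t‖ ≤ C) :
    intrinsicEDist n M (γ 0) (γ 1) ≤ ENNReal.ofReal C := by
  let := inducedENorm n M
  have := fun x : M => inducedENorm_enormSMulClass (n := n) x
  have h1 : intrinsicEDist n M (γ 0) (γ 1) ≤ pathELength (𝓡 n) γ 0 1 :=
    riemannianEDist_le_pathELength hγ rfl rfl zero_le_one
  refine h1.trans ?_
  rw [pathELength_eq_lintegral_mfderiv_Ioo]
  calc _ ≤ ∫⁻ _ in Ioo (0 : ℝ) 1, ENNReal.ofReal C := by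
        refine MeasureTheory.setLIntegral_mono measurable_const fun t ht => ?_
        have hγt : MDifferentiableAt 𝓘(ℝ, ℝ) (𝓡 n) γ t :=
          ((hγ t (Ioo_subset_Icc_self ht)).contMDiffAt
            (Icc_mem_nhds ht.1 ht.2)).mdifferentiableAt one_ne_zero
        have hval : MDifferentiableAt (𝓡 n) (𝓡 N)
            (Subtype.val : M → EuclideanSpace ℝ (Fin N)) (γ t) :=
          hM.contMDiff.mdifferentiableAt (by simp)
        have hcomp := mfderiv_comp t hval hγt
        rw [mfderiv_eq_fderiv] at hcomp
        have hd := hC t ht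
        rw [← fderiv_apply_one_eq_deriv] at hd
        change enorm (E := EuclideanSpace ℝ (Fin N)) (mfderiv (𝓡 n) (𝓡 N)
          (Subtype.val : M → EuclideanSpace ℝ (Fin N)) (γ t)
            (mfderiv 𝓘(ℝ, ℝ) (𝓡 n) γ t (1 : ℝ))) ≤ _
        have : mfderiv (𝓡 n) (𝓡 N)
          (Subtype.val : M → EuclideanSpace ℝ (Fin N)) (γ t)
            (mfderiv 𝓘(ℝ, ℝ) (𝓡 n) γ t (1 : ℝ)) =
            fderiv ℝ (fun t => (γ t : EuclideanSpace ℝ (Fin N))) t 1 :=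
          (DFunLike.congr_fun hcomp (1 : ℝ)).symm
        rw [this]
        rw [← ofReal_norm]
        exact ENNReal.ofReal_le_ofReal hd
    _ = ENNReal.ofReal C := by simp

/-- If `F` has strict derivative information near `u₀` with bounded-below derivative, the speed
of the image of a segment is almost the length of the chord. -/
theorem exists_ball_speed_le_chord {E F : Type*} [NormedAddCommGroup E] [NormedSpace ℝ E]
    [NormedAddCommGroup F] [NormedSpace ℝ F] {f : E → F} {U : Set E} (hU : IsOpen U)
    (hf : ContDiffOn ℝ 1 f U) {u₀ : E} (hu₀ : u₀ ∈ U) {K : ℝ}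
    (hK : ∀ v, ‖v‖ ≤ K * ‖fderiv ℝ f u₀ v‖) :
    ∃ ρ > 0, ball u₀ ρ ⊆ U ∧ ∀ u ∈ ball u₀ ρ, ∀ v ∈ ball u₀ ρ, ∀ w ∈ ball u₀ ρ,
      ‖fderiv ℝ f w (v - u)‖ ≤ 3 / 2 * ‖f v - f u‖ := by
  set K' := max K 1 with hK'
  have hK'pos : 0 < K' := lt_max_of_lt_right one_pos
  have hcont : ContinuousAt (fderiv ℝ f) u₀ :=
    (hf.continuousOn_fderiv_of_isOpen hU le_rfl).continuousAt (hU.mem_nhds hu₀)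
  -- Relative to `‖fderiv ℝ f u₀ (v - u)‖`, the speed is then at most `6/5` and the chord at least
  -- `4/5`, with ratio `3/2`.
  obtain ⟨ρ₁, hρ₁, h₁⟩ := Metric.continuousAt_iff.mp hcont (1 / (5 * K')) (by positivity)
  obtain ⟨ρ₂, hρ₂, h₂⟩ := Metric.isOpen_iff.mp hU u₀ hu₀
  refine ⟨min ρ₁ ρ₂, lt_min hρ₁ hρ₂, (ball_subset_ball (min_le_right _ _)).trans h₂, ?_⟩
  intro u hu v hv w hw
  have hclose : ∀ z ∈ ball u₀ (min ρ₁ ρ₂), ‖fderiv ℝ f z - fderiv ℝ f u₀‖ ≤ 1 / (5 * K') := by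
    intro z hz
    rw [← dist_eq_norm]
    exact (h₁ (ball_subset_ball (min_le_left _ _) hz)).le
  have hdiff : ∀ z ∈ ball u₀ (min ρ₁ ρ₂), DifferentiableAt ℝ f z := fun z hz =>
    (hf.differentiableOn one_ne_zero).differentiableAt
      (hU.mem_nhds (h₂ (ball_subset_ball (min_le_right _ _) hz)))
  have hinc := (convex_ball u₀ (min ρ₁ ρ₂)).norm_image_sub_le_of_norm_fderiv_le' hdiff hclose hu hv
  have hspeed : ‖fderiv ℝ f w (v - u) - fderiv ℝ f u₀ (v - u)‖ ≤ 1 / (5 * K') * ‖v - u‖ :=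
    ((fderiv ℝ f w - fderiv ℝ f u₀).le_opNorm (v - u)).trans (by gcongr; exact hclose w hw)
  have hlow : 1 / (5 * K') * ‖v - u‖ ≤ 1 / 5 * ‖fderiv ℝ f u₀ (v - u)‖ := by
    have h : ‖v - u‖ ≤ K' * ‖fderiv ℝ f u₀ (v - u)‖ :=
      (hK _).trans (by gcongr; exact le_max_left _ _)
    calc _ ≤ 1 / (5 * K') * (K' * ‖fderiv ℝ f u₀ (v - u)‖) := by gcongr
      _ = _ := by field_simp
  have e1 := norm_sub_norm_le (fderiv ℝ f w (v - u)) (fderiv ℝ f u₀ (v - u))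
  have e2 := norm_sub_norm_le (fderiv ℝ f u₀ (v - u)) (f v - f u)
  rw [norm_sub_rev (fderiv ℝ f u₀ (v - u))] at e2
  linarith

/-- The inverse of a chart adapted to the embedding, as a map into Euclidean space, is smooth and
has injective derivative. -/
theorem exists_parametrization [IsManifold (𝓡 n) ∞ M]
    (hM : IsSmoothEmbedding (𝓡 n) (𝓡 N) ∞ (Subtype.val : M → EuclideanSpace ℝ (Fin N))) (a : M) :
    ∃ e : OpenPartialHomeomorph M (EuclideanSpace ℝ (Fin n)), a ∈ e.source ∧
      ContMDiffOn (𝓡 n) (𝓡 n) ∞ e.symm e.target ∧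
      ContDiffOn ℝ ∞ (fun u => (e.symm u : EuclideanSpace ℝ (Fin N))) e.target ∧
      ∃ K : ℝ, ∀ v,
        ‖v‖ ≤ K * ‖fderiv ℝ (fun u => (e.symm u : EuclideanSpace ℝ (Fin N))) (e a) v‖ := by
  have h := hM.isImmersion.isImmersionAt a
  have hsymm : ContMDiffOn (𝓡 n) (𝓡 n) ∞ h.domChart.symm h.domChart.target :=
    contMDiffOn_symm_of_mem_maximalAtlas h.domChart_mem_maximalAtlas
  have hF : ContDiffOn ℝ ∞ (fun u => (h.domChart.symm u : EuclideanSpace ℝ (Fin N)))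
      h.domChart.target := by
    rw [← contMDiffOn_iff_contDiffOn]
    exact hM.contMDiff.comp_contMDiffOn hsymm
  refine ⟨h.domChart, h.mem_domChart_source, hsymm, hF, ?_⟩
  set F := fun u => (h.domChart.symm u : EuclideanSpace ℝ (Fin N)) with hFdef
  have hmem : h.domChart a ∈ h.domChart.target := h.domChart.map_source h.mem_domChart_source
  have hFa : F (h.domChart a) = a := by
    simp only [hFdef, h.domChart.left_inv h.mem_domChart_source]
  have hFd : DifferentiableAt ℝ F (h.domChart a) :=
    (hF.differentiableOn (by simp)).differentiableAt (h.domChart.open_target.mem_nhds hmem)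
  have hcod : ContMDiffAt (𝓡 N) (𝓡 N) ∞ h.codChart (a : EuclideanSpace ℝ (Fin N)) :=
    contMDiffAt_of_mem_maximalAtlas h.codChart_mem_maximalAtlas h.mem_codChart_source
  rw [contMDiffAt_iff_contDiffAt] at hcod
  -- In the immersion charts the inclusion is `u ↦ (u, 0)`, so `L ∘ codChart` is a local left
  -- inverse of `F`; the norm of its derivative serves as `K`.
  let L := (ContinuousLinearMap.fst ℝ (EuclideanSpace ℝ (Fin n)) h.complement).comp
    (h.equiv.symm : EuclideanSpace ℝ (Fin N) →L[ℝ] EuclideanSpace ℝ (Fin n) × h.complement)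
  have hG : DifferentiableAt ℝ (fun p => L (h.codChart p)) (F (h.domChart a)) := by
    rw [hFa]
    exact L.differentiableAt.comp _ (hcod.differentiableAt (by simp))
  have hGF : (fun p => L (h.codChart p)) ∘ F =ᶠ[𝓝 (h.domChart a)] id := by
    filter_upwards [h.domChart.open_target.mem_nhds hmem] with u hu
    have hw := h.writtenInCharts
      (show u ∈ (h.domChart.extend (𝓡 n)).target by simpa using hu)
    simp only [Function.comp_apply, OpenPartialHomeomorph.extend_coe,
      OpenPartialHomeomorph.extend_coe_symm, modelWithCornersSelf_coe,
      modelWithCornersSelf_coe_symm, id_eq] at hw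
    simp [hFdef, L, hw]
  have hder := hGF.fderiv_eq (𝕜 := ℝ)
  rw [fderiv_comp _ hG hFd, fderiv_id] at hder
  refine ⟨‖fderiv ℝ (fun p => L (h.codChart p)) (F (h.domChart a))‖, fun v => ?_⟩
  calc ‖v‖ = ‖fderiv ℝ (fun p => L (h.codChart p)) (F (h.domChart a))
        (fderiv ℝ F (h.domChart a) v)‖ := by
        rw [← ContinuousLinearMap.comp_apply, hder]; rfl
    _ ≤ _ := ContinuousLinearMap.le_opNorm _ _

/-- Locally the intrinsic distance is comparable to the Euclidean one. -/
theorem eventually_intrinsicEDist_le [IsManifold (𝓡 n) ∞ M]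
    (hM : IsSmoothEmbedding (𝓡 n) (𝓡 N) ∞ (Subtype.val : M → EuclideanSpace ℝ (Fin N))) (a : M) :
    ∃ U ∈ 𝓝 a, ∀ p ∈ U, ∀ q ∈ U,
      intrinsicEDist n M p q ≤ ENNReal.ofReal (3 / 2 * dist p q) := by
  obtain ⟨e, ha, hsymm, hF, K, hK⟩ := exists_parametrization hM a
  obtain ⟨ρ, hρ, hsub, hspeed⟩ := exists_ball_speed_le_chord e.open_target
    (hF.of_le (by simp)) (e.map_source ha) hK
  refine ⟨e.source ∩ e ⁻¹' ball (e a) ρ, inter_mem (e.open_source.mem_nhds ha)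
    ((e.continuousAt ha).preimage_mem_nhds (ball_mem_nhds _ hρ)), ?_⟩
  rintro p ⟨hp, hpρ⟩ q ⟨hq, hqρ⟩
  let l : ℝ → EuclideanSpace ℝ (Fin n) := AffineMap.lineMap (e p) (e q)
  have hl : ∀ t ∈ Icc (0 : ℝ) 1, l t ∈ ball (e a) ρ := fun t ht =>
    (convex_ball (e a) ρ).lineMap_mem hpρ hqρ ht
  have hls : ∀ t, HasDerivAt l (e q - e p) t := fun t => AffineMap.hasDerivAt_lineMap
  have hγ : ContMDiffOn 𝓘(ℝ, ℝ) (𝓡 n) 1 (fun t => e.symm (l t)) (Icc 0 1) := by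
    refine (hsymm.of_le (by simp)).comp (t := e.target) ?_ fun t ht => hsub (hl t ht)
    rw [contMDiffOn_iff_contDiffOn]
    exact (ContinuousAffineMap.lineMap (R := ℝ) (e p) (e q)).contDiff.contDiffOn
  have key := intrinsicEDist_le_of_speed_le hM hγ (C := 3 / 2 * dist p q) fun t ht => by
    have ht' := hl t (Ioo_subset_Icc_self ht)
    have hd : DifferentiableAt ℝ (fun u => (e.symm u : EuclideanSpace ℝ (Fin N))) (l t) :=
      (hF.differentiableOn (by simp)).differentiableAt (e.open_target.mem_nhds (hsub ht'))
    have := (hd.hasFDerivAt.comp_hasDerivAt t (hls t)).deriv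
    simp only [Function.comp_def] at this
    rw [this]
    refine (hspeed _ hpρ _ hqρ _ ht').trans_eq ?_
    rw [e.left_inv hp, e.left_inv hq, Subtype.dist_eq, dist_comm, dist_eq_norm]
  simpa [l, e.left_inv hp, e.left_inv hq] using key

/-- A Lipschitz curve in `M` bounds the intrinsic distance of its endpoints. -/
theorem intrinsicEDist_le_of_lipschitz [IsManifold (𝓡 n) ∞ M]
    (hM : IsSmoothEmbedding (𝓡 n) (𝓡 N) ∞ (Subtype.val : M → EuclideanSpace ℝ (Fin N)))
    {γ : ℝ → M} {C : ℝ} (hC : 0 ≤ C)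
    (hγ : ∀ s ∈ Icc (0 : ℝ) 1, ∀ t ∈ Icc (0 : ℝ) 1, dist (γ s) (γ t) ≤ C * |s - t|) :
    intrinsicEDist n M (γ 0) (γ 1) ≤ ENNReal.ofReal (3 / 2 * C) := by
  have hcont : ContinuousOn γ (Icc 0 1) :=
    (LipschitzOnWith.of_dist_le_mul (K := ⟨C, hC⟩) fun s hs t ht => hγ s hs t ht).continuousOn
  -- Near each parameter the bound passes from `t` to a later `t'` by the triangle inequality. This
  -- gives both the closedness of `S` and its extension to the right.
  have hlocal : ∀ s ∈ Icc (0 : ℝ) 1, ∃ ε > 0, ∀ t ∈ Icc (0 : ℝ) 1, ∀ t' ∈ Icc (0 : ℝ) 1,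
      |t - s| < ε → |t' - s| < ε → t ≤ t' →
      intrinsicEDist n M (γ 0) (γ t) ≤ ENNReal.ofReal (3 / 2 * C * t) →
      intrinsicEDist n M (γ 0) (γ t') ≤ ENNReal.ofReal (3 / 2 * C * t') := by
    intro s hs
    obtain ⟨U, hU, hUle⟩ := eventually_intrinsicEDist_le hM (γ s)
    obtain ⟨ε, hε, hεU⟩ := Metric.mem_nhdsWithin_iff.mp (hcont s hs hU)
    refine ⟨ε, hε, fun t ht t' ht' hts hts' htt' hle => ?_⟩
    have h1 := hUle _ (hεU ⟨by rwa [mem_ball, Real.dist_eq], ht⟩) _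
      (hεU ⟨by rwa [mem_ball, Real.dist_eq], ht'⟩)
    calc _ ≤ _ := intrinsicEDist_triangle _ (γ t) _
      _ ≤ ENNReal.ofReal (3 / 2 * C * t) + ENNReal.ofReal (3 / 2 * (C * (t' - t))) := by
        refine add_le_add hle (h1.trans (ENNReal.ofReal_le_ofReal ?_))
        have := hγ t ht t' ht'
        rw [abs_sub_comm, abs_of_nonneg (by linarith)] at this
        linarith
      _ = _ := by
        rw [← ENNReal.ofReal_add (by have := ht.1; positivity)
          (by have := sub_nonneg.mpr htt'; positivity)]
        ring_nf
  set S := {s : ℝ | ∀ t ∈ Icc (0 : ℝ) s,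
    intrinsicEDist n M (γ 0) (γ t) ≤ ENNReal.ofReal (3 / 2 * C * t)} with hS
  have hzero : (0 : ℝ) ∈ S := by
    intro t ht
    have : t = 0 := le_antisymm ht.2 ht.1
    simp [this, intrinsicEDist_self]
  have hclosed : IsClosed (S ∩ Icc 0 1) := by
    refine isClosed_of_closure_subset fun s hs => ?_
    have hs1 : s ∈ Icc (0 : ℝ) 1 := by
      have := closure_mono inter_subset_right hs
      rwa [isClosed_Icc.closure_eq] at this
    refine ⟨fun t ht => ?_, hs1⟩
    have ht1 : t ∈ Icc (0 : ℝ) 1 := ⟨ht.1, ht.2.trans hs1.2⟩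
    obtain ⟨ε, hε, hstep⟩ := hlocal t ht1
    obtain ⟨r, ⟨hrS, hr1⟩, hrs⟩ := Metric.mem_closure_iff.mp hs ε hε
    rw [Real.dist_eq] at hrs
    rcases le_total t r with htr | hrt
    · exact hrS t ⟨ht.1, htr⟩
    · have h1 := le_abs_self (s - r)
      refine hstep r hr1 t ht1 ?_ (by simpa using hε) hrt (hrS r ⟨hr1.1, le_rfl⟩)
      rw [abs_sub_comm, abs_of_nonneg (by linarith)]
      linarith [ht.2]
  have hall := hclosed.Icc_subset_of_forall_exists_gt hzero fun s hs y hy => by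
    obtain ⟨hsS, hs0, hs1⟩ := hs
    obtain ⟨ε, hε, hstep⟩ := hlocal s ⟨hs0, hs1.le⟩
    have hy' : s < y := hy
    have hmin : 0 < min (ε / 2) (min (y - s) (1 - s)) :=
      lt_min (by linarith) (lt_min (by linarith) (by linarith))
    have m1 := min_le_left (ε / 2) (min (y - s) (1 - s))
    have m2 := (min_le_right (ε / 2) (min (y - s) (1 - s))).trans (min_le_left _ _)
    have m3 := (min_le_right (ε / 2) (min (y - s) (1 - s))).trans (min_le_right _ _)
    refine ⟨s + min (ε / 2) (min (y - s) (1 - s)), fun t ht => ?_, by linarith, by linarith⟩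
    rcases le_total t s with hts | hst
    · exact hsS t ⟨ht.1, hts⟩
    · refine hstep s ⟨hs0, hs1.le⟩ t ⟨ht.1, by linarith [ht.2]⟩ (by simpa using hε) ?_ hst
        (hsS s ⟨hs0, le_rfl⟩)
      rw [abs_of_nonneg (by linarith)]
      linarith [ht.2]
  simpa using hall (right_mem_Icc.mpr zero_le_one) 1 (right_mem_Icc.mpr zero_le_one)

end IntrinsicDistance

theorem corollary5p6 (n N : ℕ) (M : Set (EuclideanSpace ℝ (Fin N)))
    [ChartedSpace (EuclideanSpace ℝ (Fin n)) M] [IsManifold (𝓡 n) ∞ M]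
    (hM : IsSmoothEmbedding (𝓡 n) (𝓡 N) ∞ (Subtype.val : M → EuclideanSpace ℝ (Fin N)))
    (hclosed : IsClosed M) (x y : M)
    (hxy : edist (x : EuclideanSpace ℝ (Fin N)) (y : EuclideanSpace ℝ (Fin N)) < reach M / 2) :
    intrinsicEDist n M x y ≤
      2 * edist (x : EuclideanSpace ℝ (Fin N)) (y : EuclideanSpace ℝ (Fin N)) := by
  obtain ⟨γ, h0, h1, hγ⟩ := exists_lipschitz_curve hclosed x.2 y.2 hxy
  have key := intrinsicEDist_le_of_lipschitz hM (by positivity) hγ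
  rw [Subtype.ext h0, Subtype.ext h1] at key
  refine key.trans_eq ?_
  rw [edist_dist, show 3 / 2 * (4 / 3 * dist (x : EuclideanSpace ℝ (Fin N)) y) =
    2 * dist (x : EuclideanSpace ℝ (Fin N)) y by ring, ENNReal.ofReal_mul zero_le_two,
    ENNReal.ofReal_ofNat]
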